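/- Let $\Gamma$ be a metric graph, i.e. sets $V$ of vertices and $E$ of edges (of any cardinality; loops and multiple edges are allowed), where every edge $e$ is identified with a segment $[0,|e|]$, $0<|e|<\infty$, whose two ends are glued to vertices. Let $L^2(\Gamma)$ be the complex $L^2$-space for the measure induced by Lebesgue measure on the edges, and let $H^1(\Gamma)$ be the space of continuous functions $f$ on $\Gamma$ such that $f|_e\in H^1(e)$ for each edge $e$ and $\int_\Gamma(|f'|^2+|f|^2)\,dx<\infty$. Let $D\subset V$ be any set of vertices (possibly empty; $D=\{o\}$ for a tree with root $o$), and let the Laplacian $-\boldsymbol\Delta$ be the operator in $L^2(\Gamma)$ associated with the quadratic form $\int_\Gamma|f'|^2dx$ on the form domain $\{f\in H^1(\Gamma): f(v)=0 \text{ for all } v\in D\}$; that is, $f\in\mathrm{Dom}(\boldsymbol\Delta)$ and $-\boldsymbol\Delta f=w\in L^2(\Gamma)$ if and only if $f$ belongs to the form domain and $\int_\Gamma f'\,\overline{g'}\,dx=\int_\Gamma w\,\overline g\,dx$ for all $g$ in the form domain. If $\sup_{e\in E}|e|=\infty$, then the spectrum of $-\boldsymbol\Delta$, as a subset of $\mathbb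 C$, is exactly $[0,\infty)$. -/

import Mathlib

noncomputable section

/-- A metric graph with vertex set `V` and edge set `E`: every edge `e` is a non-degenerate line
segment, identified with `[0, length e]`, whose end `0` is glued to the vertex `init e` and whose
end `length e` is glued to `term e`. Loops, multiple edges, vertices of infinite degree and
infinitely many vertices and edges are allowed. -/
structure MetricGraph (V E : Type*) where
  init : E → V
  term : E → V
  length : E → ℝ
  length_pos : ∀ e, 0 < length e

namespace MetricGraph

variable {V E : Type*} (G : MetricGraph V E)

/-- Lebesgue measure on the edge `e`. -/
abbrev edgeMeasure (e : E) : MeasureTheory.Measure ℝ :=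
  MeasureTheory.volume.restrict (Set.Ioc 0 (G.length e))

/-- The Hilbert space `L²(Γ)` of complex functions on the graph that are square integrable for the
measure induced by Lebesgue measure on the edges, that is, the Hilbert sum of the `L²(e)`. -/
abbrev L2 : Type _ := lp (fun e : E => MeasureTheory.Lp ℂ 2 (G.edgeMeasure e)) 2

/-- A function on the graph is given by its values `φ` at the vertices and `f e t` at the point of
the edge `e` with coordinate `t ∈ [0, length e]`. `IsH1 φ f u p` says that this function belongs to
`H¹(Γ)`, that `u ∈ L²(Γ)` is its class and `p ∈ L²(Γ)` its derivative: on each edge it is the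
primitive of its square integrable derivative (in particular it is continuous along the edge), and
its values at the ends of the edges agree with the values at the vertices. As `u` and `p` lie in
`L²(Γ)`, the `H¹` norm is finite. A function of this kind is continuous for the path metric, since
`|f x - f y|² ≤ ρ(x, y) ∫ |f'|²`. -/
structure IsH1 (φ : V → ℂ) (f : E → ℝ → ℂ) (u p : G.L2) : Prop where
  ae_eq : ∀ e, (u e : ℝ → ℂ) =ᵐ[G.edgeMeasure e] f e
  eq_integral : ∀ e, ∀ t ∈ Set.Icc 0 (G.length e), f e t = f e 0 + ∫ s in (0 : ℝ)..t, p e s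
  at_init : ∀ e, f e 0 = φ (G.init e)
  at_term : ∀ e, f e (G.length e) = φ (G.term e)

variable {G} in
theorem intervalIntegrable_edge (p : G.L2) (e : E) {t : ℝ} (ht : t ∈ Set.Icc 0 (G.length e)) :
    IntervalIntegrable (p e : ℝ → ℂ) MeasureTheory.volume 0 t := by
  have h : MeasureTheory.IntegrableOn (p e : ℝ → ℂ) (Set.Ioc 0 (G.length e)) :=
    (MeasureTheory.Lp.memLp (p e)).integrable (by norm_num)
  rw [intervalIntegrable_iff_integrableOn_Ioc_of_le ht.1]
  exact h.mono_set (Set.Ioc_subset_Ioc_right ht.2)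

variable {G} in
theorem integral_congr_edge {e : E} {g h : ℝ → ℂ} (hgh : g =ᵐ[G.edgeMeasure e] h) {t : ℝ}
    (ht : t ∈ Set.Icc 0 (G.length e)) : ∫ s in (0 : ℝ)..t, g s = ∫ s in (0 : ℝ)..t, h s := by
  rw [intervalIntegral.integral_of_le ht.1, intervalIntegral.integral_of_le ht.1]
  exact MeasureTheory.integral_congr_ae (MeasureTheory.ae_restrict_of_ae_restrict_of_subset
    (Set.Ioc_subset_Ioc_right ht.2) hgh)

/-- The pairs `(u, u')` with `u` in the form domain: `u ∈ H¹(Γ)` and `u = 0` at the vertices in the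
set `D` (`D = {o}` for a tree with the Dirichlet condition at its root `o`, `D = ∅` for a graph
without boundary). -/
def formDomain (D : Set V) : Submodule ℂ (G.L2 × G.L2) where
  carrier := {x | ∃ φ f, G.IsH1 φ f x.1 x.2 ∧ ∀ v ∈ D, φ v = 0}
  zero_mem' := by
    refine ⟨0, 0, ⟨fun e => ?_, fun e t ht => ?_, fun _ => rfl, fun _ => rfl⟩, fun _ _ => rfl⟩
    · exact MeasureTheory.Lp.coeFn_zero ℂ 2 (G.edgeMeasure e)
    · have : ((0 : G.L2) e : ℝ → ℂ) =ᵐ[G.edgeMeasure e] 0 :=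
        MeasureTheory.Lp.coeFn_zero ℂ 2 (G.edgeMeasure e)
      simp only [Prod.snd_zero]
      rw [integral_congr_edge this ht]
      simp
  add_mem' := by
    rintro ⟨u, p⟩ ⟨v, q⟩ ⟨φ, f, hf, hφ⟩ ⟨ψ, g, hg, hψ⟩
    refine ⟨φ + ψ, f + g, ⟨fun e => ?_, fun e t ht => ?_, fun e => ?_, fun e => ?_⟩,
      fun w hw => by simp [hφ w hw, hψ w hw]⟩
    · exact (MeasureTheory.Lp.coeFn_add (u e) (v e)).trans ((hf.ae_eq e).add (hg.ae_eq e))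
    · have h : ((p + q : G.L2) e : ℝ → ℂ) =ᵐ[G.edgeMeasure e] (p e : ℝ → ℂ) + (q e : ℝ → ℂ) :=
        MeasureTheory.Lp.coeFn_add (p e) (q e)
      have h1 := hf.eq_integral e t ht
      have h2 := hg.eq_integral e t ht
      simp only [Prod.mk_add_mk, Pi.add_apply] at h1 h2 ⊢
      rw [integral_congr_edge h ht]
      simp only [Pi.add_apply]
      rw [intervalIntegral.integral_add (intervalIntegrable_edge p e ht)
        (intervalIntegrable_edge q e ht), h1, h2]
      ring
    · simp [hf.at_init e, hg.at_init e]
    · simp [hf.at_term e, hg.at_term e]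
  smul_mem' := by
    rintro c ⟨u, p⟩ ⟨φ, f, hf, hφ⟩
    refine ⟨c • φ, c • f, ⟨fun e => ?_, fun e t ht => ?_, fun e => ?_, fun e => ?_⟩,
      fun w hw => by simp [hφ w hw]⟩
    · exact (MeasureTheory.Lp.coeFn_smul c (u e)).trans ((hf.ae_eq e).const_smul c)
    · have h : ((c • p : G.L2) e : ℝ → ℂ) =ᵐ[G.edgeMeasure e] c • (p e : ℝ → ℂ) :=
        MeasureTheory.Lp.coeFn_smul c (p e)
      have h1 := hf.eq_integral e t ht
      simp only [Prod.smul_mk, Pi.smul_apply] at h1 ⊢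
      rw [integral_congr_edge h ht]
      simp only [Pi.smul_apply]
      rw [intervalIntegral.integral_smul, h1, smul_add]
    · simp [hf.at_init e]
    · simp [hf.at_term e]

/-- The graph of the operator associated with the quadratic form `∫ |u'|²` on the form domain:
`u` is in the operator domain with image `w` iff `u` is in the form domain and
`∫ conj(v') u' = ∫ conj(v) w` for all `v` in the form domain. -/
def laplacianGraph (D : Set V) : Submodule ℂ (G.L2 × G.L2) where
  carrier := {x | ∃ p, (x.1, p) ∈ G.formDomain D ∧
    ∀ v q, (v, q) ∈ G.formDomain D → inner ℂ q p = inner ℂ v x.2}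
  zero_mem' := ⟨0, (G.formDomain D).zero_mem, fun v q _ => by simp⟩
  add_mem' := by
    rintro x y ⟨p, hp, hp'⟩ ⟨q, hq, hq'⟩
    refine ⟨p + q, (G.formDomain D).add_mem hp hq, fun v r h => ?_⟩
    rw [Prod.snd_add, inner_add_right, inner_add_right, hp' v r h, hq' v r h]
  smul_mem' := by
    rintro c x ⟨p, hp, hp'⟩
    refine ⟨c • p, (G.formDomain D).smul_mem c hp, fun v r h => ?_⟩
    rw [Prod.smul_snd, inner_smul_right, inner_smul_right, hp' v r h]

variable {G} in
/-- Smooth functions with compact support inside one edge belong to the form domain. -/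
theorem exists_mem_formDomain (D : Set V) (e : E) {g : ℝ → ℝ} (hg : ContDiff ℝ 1 g)
    (hs : tsupport g ⊆ Set.Ioo 0 (G.length e)) :
    ∃ v q : G.L2, (v, q) ∈ G.formDomain D ∧
      (v e : ℝ → ℂ) =ᵐ[G.edgeMeasure e] (fun t => (g t : ℂ)) ∧ ∀ e', e' ≠ e → v e' = 0 := by
  classical
  have hmem : ∀ k : ℝ → ℂ, Continuous k → MeasureTheory.MemLp k 2 (G.edgeMeasure e) := by
    intro k hk
    obtain ⟨C, hC⟩ := isCompact_Icc.exists_bound_of_continuousOn (s := Set.Icc 0 (G.length e))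
      hk.continuousOn
    refine MeasureTheory.MemLp.of_bound hk.aestronglyMeasurable C ?_
    filter_upwards [MeasureTheory.ae_restrict_mem measurableSet_Ioc] with x hx
    exact hC x (Set.Ioc_subset_Icc_self hx)
  have hd : Continuous (deriv g) := hg.continuous_deriv le_rfl
  have hgm := hmem (fun t => (g t : ℂ)) (Complex.continuous_ofReal.comp hg.continuous)
  have hdm := hmem (fun t => ((deriv g t : ℝ) : ℂ)) (Complex.continuous_ofReal.comp hd)
  have h0 : g 0 = 0 := image_eq_zero_of_notMem_tsupport fun h => lt_irrefl _ (hs h).1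
  have h1 : g (G.length e) = 0 := image_eq_zero_of_notMem_tsupport fun h => lt_irrefl _ (hs h).2
  refine ⟨lp.single 2 e (hgm.toLp _), lp.single 2 e (hdm.toLp _),
    ⟨0, Pi.single e (fun t => (g t : ℂ)), ⟨fun e' => ?_, fun e' t ht => ?_, fun e' => ?_,
      fun e' => ?_⟩, fun _ _ => rfl⟩, ?_, fun e' he => by simp [he]⟩
  · obtain rfl | he := eq_or_ne e' e
    · simpa using hgm.coeFn_toLp
    · simpa [he] using MeasureTheory.Lp.coeFn_zero ℂ 2 (G.edgeMeasure e')
  · obtain rfl | he := eq_or_ne e' e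
    · simp only [lp.single_apply_self, Pi.single_eq_same]
      rw [integral_congr_edge hdm.coeFn_toLp ht, intervalIntegral.integral_ofReal,
        intervalIntegral.integral_deriv_eq_sub
          (fun x _ => (hg.differentiable one_ne_zero) x) (hd.intervalIntegrable _ _)]
      simp
    · have h : ((lp.single 2 e (hdm.toLp _) : G.L2) e' : ℝ → ℂ) =ᵐ[G.edgeMeasure e'] 0 := by
        simpa [he] using MeasureTheory.Lp.coeFn_zero ℂ 2 (G.edgeMeasure e')
      rw [integral_congr_edge h ht]
      simp [he]
  · obtain rfl | he := eq_or_ne e' e <;> simp [*]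
  · obtain rfl | he := eq_or_ne e' e <;> simp [*]
  · simpa using hgm.coeFn_toLp

variable {G} in
/-- The form domain is dense in `L²(Γ)`. -/
theorem eq_zero_of_orthogonal_formDomain (D : Set V) (w : G.L2)
    (hw : ∀ v q, (v, q) ∈ G.formDomain D → inner ℂ v w = 0) : w = 0 := by
  ext1
  funext e
  have hint : MeasureTheory.IntegrableOn (w e : ℝ → ℂ) (Set.Ioc 0 (G.length e)) :=
    (MeasureTheory.Lp.memLp (w e)).integrable (by norm_num)
  have key := isOpen_Ioo.ae_eq_zero_of_integral_contDiff_smul_eq_zero (U := Set.Ioo 0 (G.length e))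
    (μ := MeasureTheory.volume) (f := (w e : ℝ → ℂ))
    (hint.mono_set Set.Ioo_subset_Ioc_self).locallyIntegrableOn (by
      intro g hg _ hs
      obtain ⟨v, q, hvq, hv, hv'⟩ := exists_mem_formDomain (G := G) D e
        (hg.of_le (by exact_mod_cast le_top)) hs
      have h := hw v q hvq
      rw [lp.inner_eq_tsum, tsum_eq_single e (fun e' he => by simp [hv' e' he]),
        MeasureTheory.L2.inner_def] at h
      have h2 : ∫ x, g x • (w e : ℝ → ℂ) x ∂(G.edgeMeasure e) = 0 := by
        rw [← h]
        refine MeasureTheory.integral_congr_ae ?_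
        filter_upwards [hv] with x hx
        simp [hx, mul_comm]
      rw [← h2]
      refine (MeasureTheory.setIntegral_eq_integral_of_forall_compl_eq_zero fun x hx => ?_).symm
      rw [image_eq_zero_of_notMem_tsupport fun h => hx (Set.Ioo_subset_Ioc_self (hs h)), zero_smul])
  refine MeasureTheory.Lp.ext ?_
  refine Filter.EventuallyEq.trans ?_ (MeasureTheory.Lp.coeFn_zero ℂ 2 (G.edgeMeasure e)).symm
  have hμ : G.edgeMeasure e = MeasureTheory.volume.restrict (Set.Ioo 0 (G.length e)) :=
    (MeasureTheory.Measure.restrict_congr_set MeasureTheory.Ioo_ae_eq_Ioc).symm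
  have hae : ∀ᵐ x ∂(G.edgeMeasure e), x ∈ Set.Ioo 0 (G.length e) := by
    rw [hμ]
    exact MeasureTheory.ae_restrict_mem measurableSet_Ioo
  filter_upwards [hae, MeasureTheory.ae_restrict_of_ae key] with x hx hx'
  exact hx' hx

/-- The associated operator is single valued. -/
theorem laplacianGraph_snd_eq_zero (D : Set V) (x : G.L2 × G.L2) (hx : x ∈ G.laplacianGraph D)
    (h0 : x.1 = 0) : x.2 = 0 := by
  obtain ⟨p, hp, h⟩ := hx
  have hp0 : p = 0 := by
    have := h x.1 p hp
    rw [h0, inner_zero_left] at this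
    exact inner_self_eq_zero.1 this
  refine eq_zero_of_orthogonal_formDomain D x.2 fun v q hvq => ?_
  rw [← h v q hvq, hp0, inner_zero_right]

/-- The Laplacian `-Δ` on the graph, with Dirichlet conditions at the vertices in `D` and the
natural (Kirchhoff) conditions at all other vertices: the unbounded operator in `L²(Γ)` associated
with the quadratic form `∫ |u'|²`. -/
def laplacian (D : Set V) : G.L2 →ₗ.[ℂ] G.L2 := (G.laplacianGraph D).toLinearPMap

end MetricGraph

/-- The spectrum of an unbounded operator `A` in a Hilbert space: the complex numbers `z` for which
`A - z` has no bounded everywhere defined two-sided inverse. -/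
def LinearPMap.unboundedSpectrum {H : Type*} [NormedAddCommGroup H] [InnerProductSpace ℂ H]
    (A : H →ₗ.[ℂ] H) : Set ℂ :=
  {z | ¬ ∃ R : H →L[ℂ] H,
    (∀ y : H, ∃ x : A.domain, (x : H) = R y ∧ A x - z • (x : H) = y) ∧
    ∀ x : A.domain, R (A x - z • (x : H)) = x}

end

/-! The inclusion of the spectrum in `[0, ∞)` holds for every metric graph. On pairs `(u, u')` with
the `H¹` norm, the form `∫ |u'|² - z ∫ |u|²` is coercive once `z ∉ [0, ∞)`
(`exists_pos_mul_add_le_norm_sub_mul`), so Lax–Milgram produces the resolvent. This needs the form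
domain to be complete (`isClosed_formDomain`): the vertex values are continuous functionals of `(u,
u')`, so the vertex conditions are closed.

Long edges give the converse. A plane wave `exp(i k t)` times a bump stretched over an edge of
length `ℓ` satisfies `-Δu = k² u` up to terms carrying a derivative of the bump, which are `O(1/ℓ)`
pointwise. Hence `‖(-Δ - k²)u‖ / ‖u‖ = O(1/ℓ)` (`exists_quasimode`), which excludes a bounded
inverse when `ℓ` is unbounded. The bump vanishes to second order at both ends, so neither the rest
of the graph nor the vertex conditions play any role. -/

noncomputable section

open MeasureTheory

/-! ### Operator domain elements supported on one edge -/

/-- Integration by parts for the primitive of an integrable function and a `C¹` function vanishing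
at the right end. -/
theorem setIntegral_mul_eq_neg_setIntegral_primitive_mul {ℓ : ℝ} {q m m' : ℝ → ℂ}
    (hq : IntegrableOn q (Set.Ioc 0 ℓ)) (hm : ∀ t, HasDerivAt m (m' t) t) (hm' : Continuous m')
    (hmℓ : m ℓ = 0) :
    ∫ t in Set.Ioc 0 ℓ, q t * m t = -∫ s in Set.Ioc 0 ℓ, (∫ t in (0 : ℝ)..s, q t) * m' s := by
  set μ : Measure ℝ := volume.restrict (Set.Ioc 0 ℓ) with hμ
  have hm'i : Integrable m' μ := (hm'.integrableOn_Icc (a := 0) (b := ℓ)).mono_set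
    Set.Ioc_subset_Icc_self
  -- Since `q` is merely integrable, Fubini on the triangle `t ≤ s` replaces the product rule.
  set S : Set (ℝ × ℝ) := {x | x.1 ≤ x.2} with hS
  have hSm : MeasurableSet S := measurableSet_le measurable_fst measurable_snd
  set K : ℝ × ℝ → ℂ := S.indicator fun x => q x.1 * m' x.2 with hK
  have hKi : Integrable K (μ.prod μ) := (Integrable.mul_prod hq hm'i).indicator hSm
  have hswap : ∫ t, ∫ s, K (t, s) ∂μ ∂μ = ∫ s, ∫ t, K (t, s) ∂μ ∂μ :=
    integral_integral_swap (f := fun t s => K (t, s)) hKi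
  have h1 : ∫ t in Set.Ioc 0 ℓ, q t * m t = -∫ t, ∫ s, K (t, s) ∂μ ∂μ := by
    rw [← integral_neg]
    refine setIntegral_congr_fun measurableSet_Ioc fun t ht => ?_
    have : ∀ s, K (t, s) = q t * (Set.Ici t).indicator m' s := by
      intro s
      by_cases h : t ≤ s <;> simp [hK, hS, Set.indicator, h]
    simp only [this]
    rw [integral_const_mul, integral_indicator measurableSet_Ici, hμ,
      Measure.restrict_restrict measurableSet_Ici]
    have hset : Set.Ici t ∩ Set.Ioc 0 ℓ = Set.Icc t ℓ := by
      ext s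
      simp only [Set.mem_inter_iff, Set.mem_Ici, Set.mem_Ioc, Set.mem_Icc]
      exact ⟨fun h => ⟨h.1, h.2.2⟩, fun h => ⟨h.1, ht.1.trans_le h.1, h.2⟩⟩
    rw [hset, integral_Icc_eq_integral_Ioc, ← intervalIntegral.integral_of_le ht.2,
      intervalIntegral.integral_eq_sub_of_hasDerivAt (fun x _ => hm x)
        (hm'.intervalIntegrable _ _), hmℓ]
    ring
  have h2 : ∫ s, ∫ t, K (t, s) ∂μ ∂μ = ∫ s in Set.Ioc 0 ℓ, (∫ t in (0 : ℝ)..s, q t) * m' s := by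
    refine setIntegral_congr_fun measurableSet_Ioc fun s hs => ?_
    have : ∀ t, K (t, s) = (Set.Iic s).indicator q t * m' s := by
      intro t
      by_cases h : t ≤ s <;> simp [hK, hS, Set.indicator, h]
    simp only [this]
    rw [integral_mul_const, integral_indicator measurableSet_Iic, hμ,
      Measure.restrict_restrict measurableSet_Iic, intervalIntegral.integral_of_le hs.1.le]
    have hset : Set.Iic s ∩ Set.Ioc 0 ℓ = Set.Ioc 0 s := by
      ext t
      simp only [Set.mem_inter_iff, Set.mem_Iic, Set.mem_Ioc]
      exact ⟨fun h => ⟨h.2.1, h.1⟩, fun h => ⟨h.2, h.1, h.2.trans hs.2⟩⟩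
    rw [hset]
  rw [h1, hswap, h2]

namespace MetricGraph

variable {V E : Type*} {G : MetricGraph V E}

theorem memLp_edge_of_continuousOn {e : E} {k : ℝ → ℂ}
    (hk : ContinuousOn k (Set.Icc 0 (G.length e))) : MemLp k 2 (G.edgeMeasure e) := by
  obtain ⟨C, hC⟩ := isCompact_Icc.exists_bound_of_continuousOn hk
  refine MemLp.of_bound
    ((hk.mono Set.Ioc_subset_Icc_self).aestronglyMeasurable measurableSet_Ioc) C ?_
  filter_upwards [ae_restrict_mem measurableSet_Ioc] with x hx
  exact hC x (Set.Ioc_subset_Icc_self hx)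

theorem laplacian_graph (D : Set V) : (G.laplacian D).graph = G.laplacianGraph D :=
  Submodule.toLinearPMap_graph_eq _ (G.laplacianGraph_snd_eq_zero D)

theorem integrableOn_edge {e : E} (p : Lp ℂ 2 (G.edgeMeasure e)) :
    IntegrableOn (p : ℝ → ℂ) (Set.Ioc 0 (G.length e)) :=
  (Lp.memLp p).integrable (by norm_num)

theorem continuousOn_edge_primitive {e : E} (p : Lp ℂ 2 (G.edgeMeasure e)) :
    ContinuousOn (fun t => ∫ s in (0 : ℝ)..t, p s) (Set.Icc 0 (G.length e)) := by
  have hl := G.length_pos e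
  have := intervalIntegral.continuousOn_primitive_interval (f := (p : ℝ → ℂ))
    (μ := volume) (a := 0) (b := G.length e)
    (by rw [Set.uIcc_of_le hl.le, integrableOn_Icc_iff_integrableOn_Ioc]
        exact integrableOn_edge p)
  rwa [Set.uIcc_of_le hl.le] at this

/-- A `C²` function on one edge that vanishes together with its derivative at both ends, extended
by zero, belongs to the domain of the Laplacian. -/
theorem single_mem_laplacianGraph [DecidableEq E] (D : Set V) (e : E) {f f' f'' : ℝ → ℂ}
    (hf : ∀ t, HasDerivAt f (f' t) t) (hf' : ∀ t, HasDerivAt f' (f'' t) t)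
    (hm : MemLp f 2 (G.edgeMeasure e)) (hm' : MemLp (fun t => -f'' t) 2 (G.edgeMeasure e))
    (hc : Continuous f'')
    (h0 : f 0 = 0) (h1 : f (G.length e) = 0) (h0' : f' 0 = 0) (h1' : f' (G.length e) = 0) :
    ((lp.single 2 e (hm.toLp _), lp.single 2 e (hm'.toLp _)) : G.L2 × G.L2) ∈
      G.laplacianGraph D := by
  have hcf' : Continuous f' := continuous_iff_continuousAt.2 fun t => (hf' t).continuousAt
  have hd : MemLp f' 2 (G.edgeMeasure e) := memLp_edge_of_continuousOn hcf'.continuousOn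
  -- Zero vertex values suit every `D`, and match because `f` vanishes at both ends.
  refine ⟨lp.single 2 e (hd.toLp _), ⟨0, Pi.single e f, ⟨fun e' => ?_, fun e' t ht => ?_,
    fun e' => ?_, fun e' => ?_⟩, fun _ _ => rfl⟩, ?_⟩
  · obtain rfl | he := eq_or_ne e' e
    · simpa using hm.coeFn_toLp
    · simpa [he] using Lp.coeFn_zero ℂ 2 (G.edgeMeasure e')
  · obtain rfl | he := eq_or_ne e' e
    · simp only [lp.single_apply_self, Pi.single_eq_same]
      rw [integral_congr_edge hd.coeFn_toLp ht,
        intervalIntegral.integral_eq_sub_of_hasDerivAt (fun x _ => hf x)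
          (hcf'.intervalIntegrable _ _)]
      simp
    · have h : ((lp.single 2 e (hd.toLp _) : G.L2) e' : ℝ → ℂ) =ᵐ[G.edgeMeasure e'] 0 := by
        simpa [he] using Lp.coeFn_zero ℂ 2 (G.edgeMeasure e')
      simp only
      rw [integral_congr_edge h ht]
      simp [he]
  · obtain rfl | he := eq_or_ne e' e <;> simp [*]
  · obtain rfl | he := eq_or_ne e' e <;> simp [*]
  · rintro v q ⟨φ, g, hg, -⟩
    have hl := G.length_pos e
    rw [lp.inner_single_right, lp.inner_single_right, L2.inner_def, L2.inner_def]
    have hq := integrableOn_edge (q e)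
    have hcm : ∀ t, HasDerivAt (fun t => (starRingEnd ℂ) (f' t)) ((starRingEnd ℂ) (f'' t)) t :=
      fun t => (hf' t).star
    have hcc : Continuous fun t => (starRingEnd ℂ) (f'' t) := Complex.continuous_conj.comp hc
    have key := setIntegral_mul_eq_neg_setIntegral_primitive_mul hq hcm hcc (by simp [h1'])
    have hci : IntegrableOn (fun t => (starRingEnd ℂ) (f'' t)) (Set.Ioc 0 (G.length e)) :=
      hcc.integrableOn_Icc.mono_set Set.Ioc_subset_Icc_self
    -- As `f'` vanishes at both ends, `f''` has mean zero. The primitive of `q e` may therefore be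
    -- replaced by the test function itself, whatever its values at the vertices.
    have hz : ∫ s in Set.Ioc 0 (G.length e), g e 0 * (starRingEnd ℂ) (f'' s) = 0 := by
      rw [integral_const_mul, ← intervalIntegral.integral_of_le hl.le,
        intervalIntegral.integral_eq_sub_of_hasDerivAt (fun x _ => hcm x)
          (hcc.intervalIntegrable _ _)]
      simp [h0', h1']
    have hprim := continuousOn_edge_primitive (q e)
    have hpi : IntegrableOn (fun s => (∫ t in (0 : ℝ)..s, q e t) * (starRingEnd ℂ) (f'' s))
        (Set.Ioc 0 (G.length e)) :=
      ((hprim.mul hcc.continuousOn).integrableOn_Icc).mono_set Set.Ioc_subset_Icc_self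
    have key2 : ∫ t in Set.Ioc 0 (G.length e), q e t * (starRingEnd ℂ) (f' t) =
        -∫ s in Set.Ioc 0 (G.length e), g e s * (starRingEnd ℂ) (f'' s) := by
      rw [key, ← zero_add (∫ s in Set.Ioc 0 (G.length e), _ * _), ← hz,
        ← integral_add (hci.const_mul _) hpi]
      congr 1
      refine setIntegral_congr_fun measurableSet_Ioc fun s hs => ?_
      simp only
      rw [hg.eq_integral e s (Set.Ioc_subset_Icc_self hs)]
      ring
    have key3 := congrArg (starRingEnd ℂ) key2
    rw [map_neg, ← integral_conj, ← integral_conj, ← integral_neg] at key3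
    calc _ = ∫ t in Set.Ioc 0 (G.length e), (starRingEnd ℂ) (q e t * (starRingEnd ℂ) (f' t)) := by
          refine integral_congr_ae ?_
          filter_upwards [hd.coeFn_toLp] with t ht
          simp [ht, mul_comm]
      _ = _ := key3
      _ = _ := by
          refine integral_congr_ae ?_
          filter_upwards [hm'.coeFn_toLp, hg.ae_eq e] with t ht ht'
          simp [ht, ht', mul_comm]

theorem norm_toLp_edge_sq {e : E} {f : ℝ → ℂ} (hf : MemLp f 2 (G.edgeMeasure e)) :
    ‖hf.toLp f‖ ^ 2 = ∫ t in Set.Ioc 0 (G.length e), ‖f t‖ ^ 2 := by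
  have h : ((‖hf.toLp f‖ ^ 2 : ℝ) : ℂ) =
      ((∫ t in Set.Ioc 0 (G.length e), ‖f t‖ ^ 2 : ℝ) : ℂ) := by
    rw [← integral_complex_ofReal]
    push_cast
    refine (inner_self_eq_norm_sq_to_K (𝕜 := ℂ) (hf.toLp f)).symm.trans ?_
    rw [L2.inner_def]
    refine integral_congr_ae ?_
    filter_upwards [hf.coeFn_toLp] with t ht
    rw [ht]
    exact inner_self_eq_norm_sq_to_K (𝕜 := ℂ) (f t)
  exact_mod_cast h

/-! ### Quasi-modes and the inclusion of the half-line -/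

/-- Quasi-modes: on an edge of length at least one the Laplacian has an approximate eigenvector
for `k ^ 2`, with an error inversely proportional to the length. -/
theorem exists_quasimode (D : Set V) (k : ℝ) (hk : 0 ≤ k) (e : E) (hl : 1 ≤ G.length e) :
    ∃ u w : G.L2, (u, w) ∈ G.laplacianGraph D ∧ ‖u‖ ^ 2 = G.length e / 630 ∧
      ‖w - ((k ^ 2 : ℝ) : ℂ) • u‖ ^ 2 ≤ (2 + 4 * k) ^ 2 / G.length e := by
  classical
  set ℓ := G.length e with hℓ
  have hℓ0 : 0 < ℓ := by linarith
  set X : ℝ → ℂ := fun t => Complex.exp (k * t * Complex.I) with hX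
  set s : ℝ → ℂ := fun t => ((t / ℓ : ℝ) : ℂ) with hs
  have hXd : ∀ t, HasDerivAt X (k * Complex.I * X t) t := by
    intro t
    have h1 : HasDerivAt (fun t : ℝ => (k : ℂ) * t * Complex.I) (k * Complex.I) t := by
      simpa using ((Complex.ofRealCLM.hasDerivAt (x := t)).const_mul (k : ℂ)).mul_const Complex.I
    refine h1.cexp.congr_deriv ?_
    simp only [hX]
    ring
  have hsd : ∀ t, HasDerivAt s (1 / ℓ) t := by
    intro t
    exact ((hasDerivAt_id t).div_const ℓ).ofReal_comp.congr_deriv (by simp)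
  have hXn : ∀ t, ‖X t‖ = 1 := by
    intro t
    have : X t = Complex.exp ((k * t : ℝ) * Complex.I) := by simp [hX]
    rw [this, Complex.norm_exp_ofReal_mul_I]
  -- The double zeros of `s² (1 - s)²` make `f` and `f'` vanish at both ends.
  set f : ℝ → ℂ := fun t => s t ^ 2 * (1 - s t) ^ 2 * X t with hfdef
  set f' : ℝ → ℂ := fun t => (2 * s t * (1 - s t) * (1 - 2 * s t) / ℓ +
    k * Complex.I * (s t ^ 2 * (1 - s t) ^ 2)) * X t with hf'def
  set f'' : ℝ → ℂ := fun t => ((2 - 12 * s t + 12 * s t ^ 2) / ℓ ^ 2 +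
    2 * k * Complex.I * (2 * s t * (1 - s t) * (1 - 2 * s t)) / ℓ
    - k ^ 2 * (s t ^ 2 * (1 - s t) ^ 2)) * X t with hf''def
  have hf : ∀ t, HasDerivAt f (f' t) t := by
    intro t
    have h := (((hsd t).pow 2).mul (((hsd t).const_sub 1).pow 2)).mul (hXd t)
    refine h.congr_deriv ?_
    simp only [hf'def, Pi.mul_apply, Pi.pow_apply]
    push_cast
    ring
  have hf' : ∀ t, HasDerivAt f' (f'' t) t := by
    intro t
    have ha := ((((hsd t).const_mul 2).mul ((hsd t).const_sub 1)).mul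
      (((hsd t).const_mul 2).const_sub 1)).div_const (ℓ : ℂ)
    have hb := (((hsd t).pow 2).mul (((hsd t).const_sub 1).pow 2)).const_mul (k * Complex.I)
    refine ((ha.add hb).mul (hXd t)).congr_deriv ?_
    simp only [hf''def, Pi.mul_apply, Pi.pow_apply, Pi.add_apply]
    push_cast
    linear_combination (k ^ 2 * (s t ^ 2 * (1 - s t) ^ 2) * X t) * Complex.I_sq
  have hsc : Continuous s := continuous_iff_continuousAt.2 fun t => (hsd t).continuousAt
  have hXc : Continuous X := continuous_iff_continuousAt.2 fun t => (hXd t).continuousAt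
  have hfc : Continuous f := continuous_iff_continuousAt.2 fun t => (hf t).continuousAt
  have hf''c : Continuous f'' := by fun_prop
  have hs0 : s 0 = 0 := by simp [hs]
  have hs1 : s ℓ = 1 := by simp [hs, hℓ0.ne']
  have hm : MemLp f 2 (G.edgeMeasure e) := memLp_edge_of_continuousOn hfc.continuousOn
  have hm' : MemLp (fun t => -f'' t) 2 (G.edgeMeasure e) :=
    memLp_edge_of_continuousOn hf''c.neg.continuousOn
  refine ⟨lp.single 2 e (hm.toLp _), lp.single 2 e (hm'.toLp _),
    single_mem_laplacianGraph D e hf hf' hm hm' hf''c (by simp [hfdef, hs0])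
      (by rw [← hℓ]; simp [hfdef, hs1]) (by simp [hf'def, hs0])
      (by rw [← hℓ]; simp [hf'def, hs1]), ?_, ?_⟩
  · rw [lp.norm_single (by norm_num), norm_toLp_edge_sq, ← hℓ,
      ← intervalIntegral.integral_of_le hℓ0.le]
    have h : ∀ t, ‖f t‖ ^ 2 = (fun x : ℝ => x ^ 4 - 4 * x ^ 5 + 6 * x ^ 6 - 4 * x ^ 7 + x ^ 8)
        (t / ℓ) := by
      intro t
      have h1 : f t = (((t / ℓ) ^ 2 * (1 - t / ℓ) ^ 2 : ℝ) : ℂ) * X t := by simp [hfdef, hs]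
      rw [h1, norm_mul, hXn, Complex.norm_real, mul_one, Real.norm_eq_abs, sq_abs]
      ring
    simp only [h]
    rw [intervalIntegral.integral_comp_div
      (fun x : ℝ => x ^ 4 - 4 * x ^ 5 + 6 * x ^ 6 - 4 * x ^ 7 + x ^ 8) hℓ0.ne', zero_div,
      div_self hℓ0.ne']
    -- The Beta integral `B(5, 5) = 4! 4! / 9!`.
    have hI : ∫ x in (0 : ℝ)..1, (x ^ 4 - 4 * x ^ 5 + 6 * x ^ 6 - 4 * x ^ 7 + x ^ 8) = 1 / 630 := by
      have hF : ∀ x : ℝ, HasDerivAt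
          (fun x : ℝ => x ^ 5 / 5 - 4 * (x ^ 6 / 6) + 6 * (x ^ 7 / 7) - 4 * (x ^ 8 / 8) + x ^ 9 / 9)
          (x ^ 4 - 4 * x ^ 5 + 6 * x ^ 6 - 4 * x ^ 7 + x ^ 8) x := by
        intro x
        refine ((((((hasDerivAt_pow 5 x).div_const 5).sub
          (((hasDerivAt_pow 6 x).div_const 6).const_mul 4)).add
          (((hasDerivAt_pow 7 x).div_const 7).const_mul 6)).sub
          (((hasDerivAt_pow 8 x).div_const 8).const_mul 4)).add
          ((hasDerivAt_pow 9 x).div_const 9)).congr_deriv ?_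
        norm_num
      rw [intervalIntegral.integral_eq_sub_of_hasDerivAt (fun x _ => hF x)
        (Continuous.intervalIntegrable (by fun_prop) _ _)]
      norm_num
    rw [hI, smul_eq_mul]
    ring
  · rw [← lp.single_smul, ← lp.single_sub, lp.norm_single (by norm_num), ← MemLp.toLp_const_smul,
      ← MemLp.toLp_sub, norm_toLp_edge_sq, ← hℓ]
    have hb : ∀ t ∈ Set.Ioc 0 ℓ,
        ‖‖((fun t => -f'' t) - ((k ^ 2 : ℝ) : ℂ) • f) t‖ ^ 2‖ ≤ ((2 + 4 * k) / ℓ) ^ 2 := by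
      intro t ht
      have hx0 : 0 ≤ t / ℓ := div_nonneg ht.1.le hℓ0.le
      have hx1 : t / ℓ ≤ 1 := (div_le_one hℓ0).2 ht.2
      set x := t / ℓ with hx
      have hst : s t = x := rfl
      -- The `k²` terms cancel; with `h` the bump, what remains is `-(h'' + 2 i k h') X`.
      have h1 : ((fun t => -f'' t) - ((k ^ 2 : ℝ) : ℂ) • f) t =
          -((((2 - 12 * x + 12 * x ^ 2) / ℓ ^ 2 : ℝ) : ℂ) +
            ((2 * k * (2 * x * (1 - x) * (1 - 2 * x)) / ℓ : ℝ) : ℂ) * Complex.I) * X t := by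
        simp only [hf''def, hfdef, Pi.sub_apply, Pi.smul_apply, smul_eq_mul, hst]
        push_cast
        ring
      rw [h1, norm_mul, hXn, mul_one, norm_neg, norm_pow, norm_norm]
      have hA : |2 - 12 * x + 12 * x ^ 2| ≤ 2 := by
        rw [abs_le]; constructor <;> nlinarith [sq_nonneg (2 * x - 1)]
      have hB : |2 * x * (1 - x) * (1 - 2 * x)| ≤ 2 := by
        have e1 : 0 ≤ x * (1 - x) := mul_nonneg hx0 (by linarith)
        have e2 : x * (1 - x) ≤ 1 := by nlinarith
        rw [abs_le]; constructor <;> nlinarith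
      refine pow_le_pow_left₀ (norm_nonneg _) ((norm_add_le _ _).trans ?_) 2
      rw [norm_mul, Complex.norm_I, mul_one, Complex.norm_real, Complex.norm_real,
        Real.norm_eq_abs, Real.norm_eq_abs, abs_div, abs_div, abs_mul (2 * k),
        abs_of_nonneg (by positivity : 0 ≤ 2 * k), abs_of_pos hℓ0,
        abs_of_pos (by positivity : 0 < ℓ ^ 2), add_div]
      refine add_le_add ?_ ?_
      -- Here `1 ≤ ℓ` enters, through `ℓ ≤ ℓ²`.
      · exact div_le_div₀ (by norm_num) hA hℓ0 (by nlinarith)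
      · refine div_le_div_of_nonneg_right ?_ hℓ0.le
        nlinarith
    have h2 := norm_setIntegral_le_of_norm_le_const (μ := volume) (s := Set.Ioc 0 ℓ)
      (by simp) hb
    refine (Real.le_norm_self _).trans (h2.trans (le_of_eq ?_))
    rw [Real.volume_real_Ioc_of_le hℓ0.le]
    field_simp
    ring

/-- A left inverse `R` would give `‖u‖ ≤ ‖R‖ ‖(-Δ - r) u‖`; for the quasi-modes with `k = √r` this
bounds the edge lengths. -/
theorem ofReal_mem_unboundedSpectrum_laplacian (D : Set V)
    (hG : ¬ BddAbove (Set.range G.length)) {r : ℝ} (hr : 0 ≤ r) :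
    (r : ℂ) ∈ (G.laplacian D).unboundedSpectrum := by
  rintro ⟨R, -, hR⟩
  set k := Real.sqrt r with hk
  have hkr : k ^ 2 = r := Real.sq_sqrt hr
  have hk0 : 0 ≤ k := Real.sqrt_nonneg r
  set B := ‖R‖ ^ 2 * (2 + 4 * k) ^ 2 * 630 with hB
  have hB0 : 0 ≤ B := by positivity
  -- The estimate for the quasi-mode will read `ℓ² ≤ B`, which is false for `ℓ > 1 + B`; the `1`
  -- also secures `1 ≤ ℓ`.
  obtain ⟨_, ⟨e, rfl⟩, he⟩ := not_bddAbove_iff.1 hG (1 + B)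
  have hl : 1 ≤ G.length e := by linarith
  have hl0 : 0 < G.length e := by linarith
  obtain ⟨u, w, huw, hu, hw⟩ := exists_quasimode D k hk0 e hl
  rw [← laplacian_graph, LinearPMap.mem_graph_iff] at huw
  obtain ⟨y, rfl, rfl⟩ := huw
  have h1 := R.le_opNorm (G.laplacian D y - (r : ℂ) • (y : G.L2))
  rw [hR y] at h1
  rw [hkr] at hw
  have h2 : ‖(y : G.L2)‖ ^ 2 ≤ ‖R‖ ^ 2 * ((2 + 4 * k) ^ 2 / G.length e) :=
    (pow_le_pow_left₀ (norm_nonneg _) h1 2).trans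
      (by rw [mul_pow]; exact mul_le_mul_of_nonneg_left hw (by positivity))
  rw [hu, ← mul_div_assoc, div_le_div_iff₀ (by norm_num) hl0] at h2
  nlinarith

/-! ### Vertex values and closedness of the form domain -/

/-- The functional `p ↦ ∫₀ᵗ p` on `L²(e)`. -/
def edgeIntegral (G : MetricGraph V E) (e : E) (t : ℝ) : Lp ℂ 2 (G.edgeMeasure e) →L[ℂ] ℂ :=
  innerSL ℂ (indicatorConstLp 2 (μ := G.edgeMeasure e) (measurableSet_Ioc (a := 0) (b := t))
    (measure_ne_top _ _) (1 : ℂ))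

theorem edgeIntegral_apply {e : E} {t : ℝ} (ht : t ∈ Set.Icc 0 (G.length e))
    (p : Lp ℂ 2 (G.edgeMeasure e)) : G.edgeIntegral e t p = ∫ s in (0 : ℝ)..t, p s := by
  rw [edgeIntegral, innerSL_apply_apply, L2.inner_indicatorConstLp_one,
    Measure.restrict_restrict measurableSet_Ioc, intervalIntegral.integral_of_le ht.1,
    Set.inter_eq_left.2 (Set.Ioc_subset_Ioc_right ht.2)]

theorem norm_edgeIntegral_le (e : E) (t : ℝ) :
    ‖G.edgeIntegral e t‖ ≤ (G.edgeMeasure e).real Set.univ ^ (1 / 2 : ℝ) := by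
  rw [edgeIntegral, innerSL_apply_norm, norm_indicatorConstLp (by norm_num) (by norm_num)]
  simp only [norm_one, one_mul, ENNReal.toReal_ofNat]
  exact Real.rpow_le_rpow measureReal_nonneg (measureReal_mono (Set.subset_univ _)) (by norm_num)

theorem memLp_edge_primitive {e : E} (p : Lp ℂ 2 (G.edgeMeasure e)) :
    MemLp (fun t => ∫ s in (0 : ℝ)..t, p s) 2 (G.edgeMeasure e) :=
  memLp_edge_of_continuousOn (continuousOn_edge_primitive p)

/-- The bounded operator of `L²(e)` mapping a function to its primitive vanishing at `0`. -/
def edgePrimitive (G : MetricGraph V E) (e : E) :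
    Lp ℂ 2 (G.edgeMeasure e) →L[ℂ] Lp ℂ 2 (G.edgeMeasure e) :=
  LinearMap.mkContinuous
    { toFun := fun p => (memLp_edge_primitive p).toLp _
      map_add' := fun p q => by
        rw [← MemLp.toLp_add]
        refine MemLp.toLp_congr _ _ ?_
        filter_upwards [ae_restrict_mem measurableSet_Ioc] with t ht
        simp only [Pi.add_apply, ← edgeIntegral_apply (Set.Ioc_subset_Icc_self ht), map_add]
      map_smul' := fun c p => by
        rw [RingHom.id_apply, ← MemLp.toLp_const_smul]
        refine MemLp.toLp_congr _ _ ?_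
        filter_upwards [ae_restrict_mem measurableSet_Ioc] with t ht
        simp only [Pi.smul_apply, ← edgeIntegral_apply (Set.Ioc_subset_Icc_self ht), map_smul] }
    (measureUnivNNReal (G.edgeMeasure e) ^ (2 : ENNReal).toReal⁻¹ *
      (G.edgeMeasure e).real Set.univ ^ (1 / 2 : ℝ)) fun p => by
    rw [mul_assoc]
    refine Lp.norm_le_of_ae_bound (by positivity) ?_
    filter_upwards [ae_restrict_mem measurableSet_Ioc, (memLp_edge_primitive p).coeFn_toLp]
      with t ht h
    refine (congrArg norm h).trans_le ?_
    rw [← edgeIntegral_apply (Set.Ioc_subset_Icc_self ht)]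
    exact (G.edgeIntegral e t).le_of_opNorm_le (norm_edgeIntegral_le e t) p

theorem coeFn_edgePrimitive {e : E} (p : Lp ℂ 2 (G.edgeMeasure e)) :
    (G.edgePrimitive e p : ℝ → ℂ) =ᵐ[G.edgeMeasure e] fun t => ∫ s in (0 : ℝ)..t, p s :=
  (memLp_edge_primitive p).coeFn_toLp

/-- The value at `0` of the function on the edge `e` with class `u` and derivative `p`, as a
functional on all pairs `(u, p)`. -/
def initValue (G : MetricGraph V E) (e : E) (x : G.L2 × G.L2) : ℂ :=
  (G.length e : ℂ)⁻¹ * G.edgeIntegral e (G.length e) (x.1 e - G.edgePrimitive e (x.2 e))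

/-- The value at `length e` of the function on the edge `e`. -/
def termValue (G : MetricGraph V E) (e : E) (x : G.L2 × G.L2) : ℂ :=
  G.initValue e x + G.edgeIntegral e (G.length e) (x.2 e)

theorem continuous_eval_L2 (e : E) : Continuous fun u : G.L2 => u e :=
  (lp.evalCLM ℂ (fun e : E => Lp ℂ 2 (G.edgeMeasure e)) 2 e).continuous

theorem continuous_initValue (e : E) : Continuous (G.initValue e) := by
  have h1 := (continuous_eval_L2 (G := G) e).comp (continuous_fst (X := G.L2) (Y := G.L2))
  have h2 := (continuous_eval_L2 (G := G) e).comp (continuous_snd (X := G.L2) (Y := G.L2))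
  exact continuous_const.mul ((G.edgeIntegral e _).continuous.comp
    (h1.sub ((G.edgePrimitive e).continuous.comp h2)))

theorem continuous_termValue (e : E) : Continuous (G.termValue e) :=
  (continuous_initValue e).add ((G.edgeIntegral e _).continuous.comp
    ((continuous_eval_L2 (G := G) e).comp continuous_snd))

/-- On the edge, `u` minus the primitive of `p` is the constant `f e 0`, which averaging recovers.
The endpoint value is thus visibly continuous in `(u, p)`. -/
theorem IsH1.initValue_eq {φ : V → ℂ} {f : E → ℝ → ℂ} {u p : G.L2} (h : G.IsH1 φ f u p) (e : E) :
    G.initValue e (u, p) = f e 0 := by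
  have hl := G.length_pos e
  have hlm : G.length e ∈ Set.Icc 0 (G.length e) := ⟨hl.le, le_rfl⟩
  rw [initValue, edgeIntegral_apply hlm, integral_congr_edge (h := fun _ => f e 0) _ hlm]
  · have : (G.length e : ℂ) ≠ 0 := by exact_mod_cast hl.ne'
    simp [this]
  · filter_upwards [Lp.coeFn_sub (u e) (G.edgePrimitive e (p e)), h.ae_eq e,
      coeFn_edgePrimitive (p e), ae_restrict_mem measurableSet_Ioc] with t h1 h2 h3 ht
    rw [h1, Pi.sub_apply, h2, h3, h.eq_integral e t (Set.Ioc_subset_Icc_self ht)]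
    ring

theorem IsH1.termValue_eq {φ : V → ℂ} {f : E → ℝ → ℂ} {u p : G.L2} (h : G.IsH1 φ f u p) (e : E) :
    G.termValue e (u, p) = f e (G.length e) := by
  have hlm : G.length e ∈ Set.Icc 0 (G.length e) := ⟨(G.length_pos e).le, le_rfl⟩
  rw [termValue, h.initValue_eq, h.eq_integral e _ hlm, edgeIntegral_apply hlm]

/-- A description of the form domain by closed conditions. -/
theorem mem_formDomain_iff (D : Set V) (x : G.L2 × G.L2) :
    x ∈ G.formDomain D ↔
      (∀ e, x.1 e = Lp.constL 2 (G.edgeMeasure e) ℂ (G.initValue e x) +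
        G.edgePrimitive e (x.2 e)) ∧
      (∀ i j : E ⊕ E, Sum.elim G.init G.term i = Sum.elim G.init G.term j →
        Sum.elim G.initValue G.termValue i x = Sum.elim G.initValue G.termValue j x) ∧
      ∀ i : E ⊕ E, Sum.elim G.init G.term i ∈ D →
        Sum.elim G.initValue G.termValue i x = 0 := by
  constructor
  · obtain ⟨u, p⟩ := x
    rintro ⟨φ, f, h, hφ⟩
    have hval : ∀ i : E ⊕ E, Sum.elim G.initValue G.termValue i (u, p) =
        φ (Sum.elim G.init G.term i) := by
      rintro (e | e)
      · simp [h.initValue_eq, h.at_init]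
      · simp [h.termValue_eq, h.at_term]
    refine ⟨fun e => Lp.ext ?_, fun i j hij => by rw [hval, hval, hij],
      fun i hi => by rw [hval, hφ _ hi]⟩
    filter_upwards [Lp.coeFn_add (Lp.constL 2 (G.edgeMeasure e) ℂ (G.initValue e (u, p)))
      (G.edgePrimitive e (p e)), h.ae_eq e, coeFn_edgePrimitive (p e),
      Lp.coeFn_const 2 (G.edgeMeasure e) (G.initValue e (u, p)),
      ae_restrict_mem measurableSet_Ioc] with t h1 h2 h3 h4 ht
    rw [h1, h2, Pi.add_apply, h3, h.eq_integral e t (Set.Ioc_subset_Icc_self ht)]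
    congr 1
    exact (h4.trans (h.initValue_eq e)).symm
  · rintro ⟨h1, h2, h3⟩
    -- The vertex function is read off from the edge ends, consistently by `h2`. Vertices without
    -- edges get the default `0`, which respects the condition on `D`.
    have hext : ∀ i : E ⊕ E, Function.extend (Sum.elim G.init G.term)
        (fun i => Sum.elim G.initValue G.termValue i x) 0 (Sum.elim G.init G.term i) =
        Sum.elim G.initValue G.termValue i x := fun i =>
      Function.FactorsThrough.extend_apply (fun i j hij => h2 i j hij) _ _
    refine ⟨Function.extend (Sum.elim G.init G.term)
      (fun i => Sum.elim G.initValue G.termValue i x) 0,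
      fun e t => G.initValue e x + ∫ s in (0 : ℝ)..t, x.2 e s,
      ⟨fun e => ?_, fun e t _ => by simp, fun e => ?_, fun e => ?_⟩, fun v hv => ?_⟩
    · conv_lhs => rw [h1 e]
      filter_upwards [Lp.coeFn_add (Lp.constL 2 (G.edgeMeasure e) ℂ (G.initValue e x))
        (G.edgePrimitive e (x.2 e)), coeFn_edgePrimitive (x.2 e),
        Lp.coeFn_const 2 (G.edgeMeasure e) (G.initValue e x)] with t h1 h3 h4
      rw [h1, Pi.add_apply, h3]
      congr 1
    · simpa using (hext (Sum.inl e)).symm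
    · have := hext (Sum.inr e)
      simp only [Sum.elim_inr] at this
      rw [this, termValue, edgeIntegral_apply ⟨(G.length_pos e).le, le_rfl⟩]
    · by_cases h : ∃ i, Sum.elim G.init G.term i = v
      · obtain ⟨i, rfl⟩ := h
        rw [hext, h3 i hv]
      · rw [Function.extend_apply' _ _ _ h, Pi.zero_apply]

/-- An intersection of equalities between continuous maps, each involving at most two edges. Bounds
uniform in the edge are not needed, so short edges do no harm. -/
theorem isClosed_formDomain (D : Set V) : IsClosed (G.formDomain D : Set (G.L2 × G.L2)) := by
  have hval : ∀ i : E ⊕ E, Continuous (Sum.elim G.initValue G.termValue i) := by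
    rintro (e | e)
    · exact continuous_initValue e
    · exact continuous_termValue e
  have heq : (G.formDomain D : Set (G.L2 × G.L2)) =
      (⋂ e, {x | x.1 e = Lp.constL 2 (G.edgeMeasure e) ℂ (G.initValue e x) +
        G.edgePrimitive e (x.2 e)}) ∩
      ((⋂ (i : E ⊕ E) (j : E ⊕ E) (_ : Sum.elim G.init G.term i = Sum.elim G.init G.term j),
        {x | Sum.elim G.initValue G.termValue i x = Sum.elim G.initValue G.termValue j x}) ∩
      ⋂ (i : E ⊕ E) (_ : Sum.elim G.init G.term i ∈ D),
        {x | Sum.elim G.initValue G.termValue i x = 0}) := by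
    ext x
    simp only [SetLike.mem_coe, mem_formDomain_iff, Set.mem_inter_iff, Set.mem_iInter,
      Set.mem_ofPred_eq]
  rw [heq]
  refine IsClosed.inter ?_ (IsClosed.inter ?_ ?_)
  · refine isClosed_iInter fun e =>
      isClosed_eq ((continuous_eval_L2 (G := G) e).comp continuous_fst) ?_
    exact ((Lp.constL 2 (G.edgeMeasure e) ℂ).continuous.comp (continuous_initValue e)).add
      ((G.edgePrimitive e).continuous.comp ((continuous_eval_L2 (G := G) e).comp continuous_snd))
  · exact isClosed_iInter fun i => isClosed_iInter fun j => isClosed_iInter fun _ =>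
      isClosed_eq (hval i) (hval j)
  · exact isClosed_iInter fun i => isClosed_iInter fun _ => isClosed_eq (hval i) continuous_const

end MetricGraph

/-! ### Coercivity and the resolvent off the half-line -/

/-- For `z` off the positive half-line the form `b - z a` is coercive on the quadrant. -/
theorem exists_pos_mul_add_le_norm_sub_mul {z : ℂ} (hz : ¬ ∃ r : ℝ, 0 ≤ r ∧ z = r) :
    ∃ c : NNReal, 0 < c ∧ ∀ a b : ℝ, 0 ≤ a → 0 ≤ b → (a + b) * c ≤ ‖(b : ℂ) - z * a‖ := by
  by_cases him : z.im = 0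
  · have hre : z.re < 0 := by
      by_contra h
      exact hz ⟨z.re, not_lt.1 h, Complex.ext rfl him⟩
    have hm : 0 < min (-z.re) 1 := lt_min (by linarith) one_pos
    refine ⟨⟨min (-z.re) 1, hm.le⟩, hm, fun a b ha hb => ?_⟩
    have h1 := (le_abs_self _).trans (Complex.abs_re_le_norm ((b : ℂ) - z * a))
    simp only [Complex.sub_re, Complex.ofReal_re, Complex.re_mul_ofReal] at h1
    have h2 : a * min (-z.re) 1 ≤ a * (-z.re) := mul_le_mul_of_nonneg_left (min_le_left _ _) ha
    have h3 : b * min (-z.re) 1 ≤ b * 1 := mul_le_mul_of_nonneg_left (min_le_right _ _) hb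
    change (a + b) * min (-z.re) 1 ≤ _
    nlinarith
  · have hy : 0 < |z.im| := abs_pos.2 him
    have hd : 0 < |z.im| + 1 + |z.re| := by positivity
    have hc : 0 < |z.im| / (|z.im| + 1 + |z.re|) := by positivity
    -- With `N` the norm on the right, `a |Im z| ≤ N` and `b ≤ N + |Re z| a`. Multiplying the second
    -- by `|Im z|` and adding gives `(a + b) |Im z| ≤ N (1 + |Im z| + |Re z|)`.
    refine ⟨⟨|z.im| / (|z.im| + 1 + |z.re|), hc.le⟩, hc, fun a b ha hb => ?_⟩
    have h1 := (le_abs_self _).trans (Complex.abs_re_le_norm ((b : ℂ) - z * a))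
    have h2 := Complex.abs_im_le_norm ((b : ℂ) - z * a)
    simp only [Complex.sub_re, Complex.ofReal_re, Complex.re_mul_ofReal] at h1
    simp only [Complex.sub_im, Complex.ofReal_im, Complex.im_mul_ofReal, zero_sub, abs_neg,
      abs_mul, abs_of_nonneg ha] at h2
    change (a + b) * (|z.im| / (|z.im| + 1 + |z.re|)) ≤ _
    set N := ‖(b : ℂ) - z * a‖
    rw [← mul_div_assoc, div_le_iff₀ hd]
    have h3 : z.re * a ≤ |z.re| * a := mul_le_mul_of_nonneg_right (le_abs_self _) ha
    have h4 : b * |z.im| ≤ (N + |z.re| * a) * |z.im| :=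
      mul_le_mul_of_nonneg_right (by linarith) hy.le
    have h5 : |z.re| * (|z.im| * a) ≤ |z.re| * N := mul_le_mul_of_nonneg_left h2 (abs_nonneg _)
    nlinarith

namespace MetricGraph

variable {V E : Type*} {G : MetricGraph V E}

/-- The form domain as a subspace of the Hilbert space `L²(Γ) ⊕ L²(Γ)`. -/
def formSpace (G : MetricGraph V E) (D : Set V) : Submodule ℂ (WithLp 2 (G.L2 × G.L2)) :=
  (G.formDomain D).comap (WithLp.linearEquiv 2 ℂ (G.L2 × G.L2)).toLinearMap

instance (D : Set V) : CompleteSpace (G.formSpace D) :=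
  IsClosed.completeSpace_coe
    (hs := (isClosed_formDomain D).preimage (WithLp.prod_continuous_ofLp 2 G.L2 G.L2))

/-- The operator on `L²(Γ) ⊕ L²(Γ)` acting as `-z` on the first and as `1` on the second summand. -/
def formMultiplier (G : MetricGraph V E) (z : ℂ) :
    WithLp 2 (G.L2 × G.L2) →L[ℂ] WithLp 2 (G.L2 × G.L2) :=
  (WithLp.prodContinuousLinearEquiv 2 ℂ G.L2 G.L2).symm.toContinuousLinearMap ∘L
    ((-z • WithLp.fstL 2 ℂ G.L2 G.L2).prod (WithLp.sndL 2 ℂ G.L2 G.L2))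

/-- The operator on the form domain representing the form `∫ |u'|² - z ∫ |u|²`. -/
def formOperator (G : MetricGraph V E) (D : Set V) (z : ℂ) :
    G.formSpace D →L[ℂ] G.formSpace D :=
  (G.formSpace D).orthogonalProjectionOnto ∘L G.formMultiplier z ∘L (G.formSpace D).subtypeL

theorem inner_formOperator (D : Set V) (z : ℂ) (x y : G.formSpace D) :
    inner ℂ y (G.formOperator D z x) =
      inner ℂ (y : WithLp 2 (G.L2 × G.L2)).snd (x : WithLp 2 (G.L2 × G.L2)).snd
      - z * inner ℂ (y : WithLp 2 (G.L2 × G.L2)).fst (x : WithLp 2 (G.L2 × G.L2)).fst := by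
  have h := Submodule.inner_orthogonalProjectionOnto_eq_of_mem_left (K := G.formSpace D) y
    (G.formMultiplier z x)
  refine h.trans ?_
  rw [WithLp.prod_inner_apply]
  simp only [formMultiplier, ContinuousLinearMap.comp_apply, ContinuousLinearMap.prod_apply,
    ContinuousLinearEquiv.coe_coe, WithLp.prodContinuousLinearEquiv_symm_apply,
    smul_apply, WithLp.fstL_apply, WithLp.sndL_apply, inner_smul_right]
  rw [neg_mul, neg_add_eq_sub]
  rfl

/-- The element of the form domain representing the functional `v ↦ ∫ conj(v) w`. -/
def formSource (G : MetricGraph V E) (D : Set V) : G.L2 →L[ℂ] G.formSpace D :=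
  (G.formSpace D).orthogonalProjectionOnto ∘L
    (WithLp.prodContinuousLinearEquiv 2 ℂ G.L2 G.L2).symm.toContinuousLinearMap ∘L
      ContinuousLinearMap.inl ℂ G.L2 G.L2

theorem inner_formSource (D : Set V) (w : G.L2) (y : G.formSpace D) :
    inner ℂ y (G.formSource D w) = inner ℂ (y : WithLp 2 (G.L2 × G.L2)).fst w := by
  have h := Submodule.inner_orthogonalProjectionOnto_eq_of_mem_left (K := G.formSpace D) y
    (WithLp.toLp 2 (w, (0 : G.L2)))
  refine h.trans ?_
  rw [WithLp.prod_inner_apply]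
  simp

/-- Lax–Milgram: coercivity is applied with `a = ‖u‖²` and `b = ‖u'‖²`, whose sum is the squared
norm in `formSpace`. -/
theorem isUnit_formOperator (D : Set V) {z : ℂ} (hz : ¬ ∃ r : ℝ, 0 ≤ r ∧ z = r) :
    IsUnit (G.formOperator D z) := by
  obtain ⟨c, hc, h⟩ := exists_pos_mul_add_le_norm_sub_mul hz
  refine ContinuousLinearMap.isUnit_of_forall_le_norm_inner_map _ hc fun x => ?_
  rw [norm_inner_symm, inner_formOperator, Submodule.coe_norm, WithLp.prod_norm_sq_eq_of_L2,
    inner_self_eq_norm_sq_to_K, inner_self_eq_norm_sq_to_K]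
  have hx := h (‖(x : WithLp 2 (G.L2 × G.L2)).fst‖ ^ 2) (‖(x : WithLp 2 (G.L2 × G.L2)).snd‖ ^ 2)
    (by positivity) (by positivity)
  push_cast at hx
  exact hx

/-- The weak formulation of `-Δ u = w` in terms of the operators of the form. -/
theorem mem_laplacianGraph_iff (D : Set V) (z : ℂ) (u w : G.L2) :
    (u, w) ∈ G.laplacianGraph D ↔ ∃ x : G.formSpace D,
      (x : WithLp 2 (G.L2 × G.L2)).fst = u ∧ G.formOperator D z x = G.formSource D (w - z • u) := by
  constructor
  · rintro ⟨p, hp, h⟩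
    refine ⟨⟨WithLp.toLp 2 (u, p), hp⟩, rfl, ext_inner_left ℂ fun y => ?_⟩
    rw [inner_formOperator, inner_formSource, inner_sub_right, inner_smul_right]
    exact congrArg (· - _) (h _ _ y.2)
  · rintro ⟨x, rfl, hx⟩
    refine ⟨(x : WithLp 2 (G.L2 × G.L2)).snd, x.2, fun v q hvq => ?_⟩
    have h := congrArg (inner ℂ (⟨WithLp.toLp 2 (v, q), hvq⟩ : G.formSpace D)) hx
    rw [inner_formOperator, inner_formSource, inner_sub_right, inner_smul_right] at h
    exact sub_left_injective h

/-- The resolvent sends `y` to the first component of the solution `X` of `formOperator X =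
formSource y`. -/
theorem notMem_unboundedSpectrum_laplacian (D : Set V) {z : ℂ}
    (hz : ¬ ∃ r : ℝ, 0 ≤ r ∧ z = r) : z ∉ (G.laplacian D).unboundedSpectrum := by
  obtain ⟨T, hT⟩ := isUnit_formOperator (G := G) D hz
  have hTS : ∀ x, G.formOperator D z ((↑T⁻¹ : G.formSpace D →L[ℂ] G.formSpace D) x) = x := by
    intro x
    rw [← hT]
    exact DFunLike.congr_fun T.mul_inv x
  have hST : ∀ x, (↑T⁻¹ : G.formSpace D →L[ℂ] G.formSpace D) (G.formOperator D z x) = x := by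
    intro x
    rw [← hT]
    exact DFunLike.congr_fun T.inv_mul x
  refine not_not_intro ⟨WithLp.fstL 2 ℂ G.L2 G.L2 ∘L (G.formSpace D).subtypeL ∘L
    (↑T⁻¹ : G.formSpace D →L[ℂ] G.formSpace D) ∘L G.formSource D, fun y => ?_, fun x => ?_⟩
  · set X := (↑T⁻¹ : G.formSpace D →L[ℂ] G.formSpace D) (G.formSource D y) with hX
    have hmem : ((X : WithLp 2 (G.L2 × G.L2)).fst,
        y + z • (X : WithLp 2 (G.L2 × G.L2)).fst) ∈ G.laplacianGraph D :=
      (mem_laplacianGraph_iff D z _ _).2 ⟨X, rfl, by rw [add_sub_cancel_right, hX, hTS]⟩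
    rw [← laplacian_graph, LinearPMap.mem_graph_iff] at hmem
    obtain ⟨x, hx1, hx2⟩ := hmem
    refine ⟨x, hx1, ?_⟩
    rw [hx2, hx1]
    exact add_sub_cancel_right _ _
  · have hmem : ((x : G.L2), G.laplacian D x) ∈ G.laplacianGraph D := by
      rw [← laplacian_graph]
      exact LinearPMap.mem_graph _ x
    obtain ⟨X, hX1, hX2⟩ := (mem_laplacianGraph_iff D z _ _).1 hmem
    simp only [ContinuousLinearMap.comp_apply]
    rw [← hX2, hST]
    exact hX1

end MetricGraph

theorem theorem5p2 {V E : Type*} (G : MetricGraph V E) (D : Set V)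
    (hG : ¬ BddAbove (Set.range G.length)) :
    (G.laplacian D).unboundedSpectrum = {z : ℂ | ∃ r : ℝ, 0 ≤ r ∧ z = r} := by
  ext z
  refine ⟨fun hz => ?_, ?_⟩
  · by_contra h
    exact MetricGraph.notMem_unboundedSpectrum_laplacian D h hz
  · rintro ⟨r, hr, rfl⟩
    exact MetricGraph.ofReal_mem_unboundedSpectrum_laplacian D hG hr

end
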